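/- **Formulae.** Consider the formulae of linear logic without propositional variables $$A,B ::= 0 \mid 1 \mid A\otimes B \mid A\oplus B \mid {?}A \mid \top \mid \bot \mid A ⅋ B \mid A \mathbin{\&} B \mid {!}A,$$ the first five forms being positive and the last five negative, with linear negation $A^\perp$ given by De Morgan duality ($0/\top$, $1/\bot$, $\otimes/⅋$, $\oplus/\&$, $?/!$). Put $\otimes^0A=1$, $\otimes^{n+1}A=(\otimes^nA)\otimes A$, $⅋^0A=\bot$, $⅋^{n+1}A=(⅋^nA)⅋A$. **Game.** A *position* is a finite tree with a selected vertex (which *holds the token*), each vertex being signed as proponent or opponent, and each edge being directed and labelled with a positive formula. An edge labelled with a negative formula denotes the reversed edge labelled with the dual formula. The vertex $v$ holding the token can make the following *moves* (up to isomorphism; the sign of a vertex is inherited, and after the move the token is at the other end $v'$ of the edge acted upon): - along an edge $v'\to v$: pass the token to $v'$, the tree being unchanged; - if an edge $v\to v'$ labelled $1$ is the only edge at $v$: delete $v$ and this edge; - on an edge $v\to v'$ labelled $A\oplus B$: relabel it $A$, or relabel it $B$; - on an edge $v\to v'$ labelled ${?}A^\perp$: for some $n\ge 0$, replace it by an edge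 $v'\to v$ labelled $\otimes^nA$; - on an edge $v\to v'$ labelled $A\otimes B$: distribute the other subtrees at $v$ into three families $\Gamma,\Gamma',{?}\Theta$, where those in ${?}\Theta$ are all attached by edges going out of $v$ with labels of the form ${?}C$; replace $v$ by two vertices $v_1,v_2$, with edges $v_1\to v'$ labelled $A$ and $v_2\to v'$ labelled $B$, where $v_1$ receives $\Gamma$ and a copy of ${?}\Theta$, and $v_2$ receives $\Gamma'$ and a second copy of ${?}\Theta$. A *play* from a position is a finite sequence of successive moves from it. A *strategy* on a position is a set of plays from it that contains the empty play, is closed under prefixes, is closed under isomorphism of plays, and contains, with each play at whose end an opponent holds the token, every extension of that play by one move. It is *winning* if an opponent holds the token at the end of each play of the strategy that has no proper extension in the strategy. A formula $A$ is *GLLTN-valid* if there is a finite tree $U$ (directed and labelled as above, with a chosen vertex $l$) such that for every finite tree $V$ (of the same kind, with a chosen vertex $r$), in the tree obtained by joining $U$ and $V$ by an edge $l\to r$ labelled $A$, with the vertices of $U$ as proponents and those of $V$ as opponents, there is a winning strategy for every initial placement of the token. **Calculus.** LLTN is the sequent calculus, on lists of formulae, whose proofs are the (possibly infinitely branching) trees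 with all branches finite built from the rules $$\frac{}{1}\quad \frac{\Gamma}{\Gamma,\bot}\quad \frac{}{\Gamma,\top}\quad \frac{\Gamma,{?}\Theta,A\quad \Delta,{?}\Theta,B}{\Gamma,\Delta,{?}\Theta,A\otimes B}\quad \frac{\Gamma,A,B}{\Gamma,A⅋B}\quad \frac{\Gamma,A}{\Gamma,A\oplus B}\quad \frac{\Gamma,B}{\Gamma,A\oplus B}\quad \frac{\Gamma,A\quad\Gamma,B}{\Gamma,A\mathbin{\&}B}$$ $$\frac{\Gamma,⅋^nA}{\Gamma,{?}A}\ (n\ge0)\quad \frac{\Gamma,\otimes^nA\ \text{ for all } n\ge 0}{\Gamma,{!}A}\quad \frac{\Gamma,B,A,\Delta}{\Gamma,A,B,\Delta}\quad \frac{\Gamma,A\quad \Delta,A^\perp}{\Gamma,\Delta}.$$ **Theorem.** For no formula $A$ are both $A$ and $A^\perp$ GLLTN-valid. Moreover, LLTN is consistent: for no formula $A$ are both $A$ and $A^\perp$ provable in LLTN. -/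

import Mathlib

namespace GLLTN

/-! ## Formulae -/

/-- Formulae of linear logic without propositional variables.  The first five are positive,
the last five are negative. -/
inductive Formula : Type
  | zero : Formula
  | one : Formula
  | tensor : Formula → Formula → Formula
  | plus : Formula → Formula → Formula
  | whynot : Formula → Formula
  | top : Formula
  | bot : Formula
  | par : Formula → Formula → Formula
  | wth : Formula → Formula → Formula
  | bang : Formula → Formula

/-- De Morgan duality (linear negation). -/
def Formula.dual : Formula → Formula
  | .zero => .top
  | .one => .bot
  | .tensor A B => .par A.dual B.dual
  | .plus A B => .wth A.dual B.dual
  | .whynot A => .bang A.dual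
  | .top => .zero
  | .bot => .one
  | .par A B => .tensor A.dual B.dual
  | .wth A B => .plus A.dual B.dual
  | .bang A => .whynot A.dual

/-- The negative formulae: `⊤`, `⊥`, `A ⅋ B`, `A & B`, `!A`. -/
def Formula.IsNegative : Formula → Prop
  | .zero | .one | .tensor _ _ | .plus _ _ | .whynot _ => False
  | .top | .bot | .par _ _ | .wth _ _ | .bang _ => True

/-- `⊗⁰ A = 1` and `⊗ⁿ⁺¹ A = (⊗ⁿ A) ⊗ A`. -/
def Formula.tensorPow (A : Formula) : ℕ → Formula
  | 0 => .one
  | n + 1 => .tensor (A.tensorPow n) A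

/-- `⅋⁰ A = ⊥` and `⅋ⁿ⁺¹ A = (⅋ⁿ A) ⅋ A`. -/
def Formula.parPow (A : Formula) : ℕ → Formula
  | 0 => .bot
  | n + 1 => .par (A.parPow n) A

/-! ## The sequent calculus -/

/-- Provability in the infinitary sequent calculus (with cut).  Sequents are lists of formulae;
being an inductive predicate, it speaks of derivation trees all of whose branches are finite. -/
inductive Provable : List Formula → Prop
  | one : Provable [.one]
  | bot (Γ : List Formula) : Provable Γ → Provable (Γ ++ [.bot])
  | top (Γ : List Formula) : Provable (Γ ++ [.top])
  | tensor (Γ Δ Θ : List Formula) (A B : Formula) :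
      Provable (Γ ++ Θ.map Formula.whynot ++ [A]) →
      Provable (Δ ++ Θ.map Formula.whynot ++ [B]) →
      Provable (Γ ++ Δ ++ Θ.map Formula.whynot ++ [.tensor A B])
  | par (Γ : List Formula) (A B : Formula) :
      Provable (Γ ++ [A, B]) → Provable (Γ ++ [.par A B])
  | plusLeft (Γ : List Formula) (A B : Formula) :
      Provable (Γ ++ [A]) → Provable (Γ ++ [.plus A B])
  | plusRight (Γ : List Formula) (A B : Formula) :
      Provable (Γ ++ [B]) → Provable (Γ ++ [.plus A B])
  | wth (Γ : List Formula) (A B : Formula) :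
      Provable (Γ ++ [A]) → Provable (Γ ++ [B]) → Provable (Γ ++ [.wth A B])
  | whynot (Γ : List Formula) (A : Formula) (n : ℕ) :
      Provable (Γ ++ [A.parPow n]) → Provable (Γ ++ [.whynot A])
  | bang (Γ : List Formula) (A : Formula) :
      (∀ n : ℕ, Provable (Γ ++ [A.tensorPow n])) → Provable (Γ ++ [.bang A])
  | exchange (Γ Δ : List Formula) (A B : Formula) :
      Provable (Γ ++ [B, A] ++ Δ) → Provable (Γ ++ [A, B] ++ Δ)
  | cut (Γ Δ : List Formula) (A : Formula) :
      Provable (Γ ++ [A]) → Provable (Δ ++ [A.dual]) → Provable (Γ ++ Δ)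

/-! ## Positions -/

/-- The sign of a vertex. -/
inductive Player : Type
  | proponent : Player
  | opponent : Player

/-- A finite punctured, directed, signed, normally labelled tree, unfolded from its selected
vertex: the sign of that vertex, and for each adjacent edge the formula by which the vertex sees
it, together with the subtree at its other end (punctured there).

An entry `(A, t)` with `A` positive is an edge labelled `A` going from the vertex to the root of
`t` (an output); an entry `(A, t)` with `A` negative is an edge labelled with the positive formula
`A.dual` going from the root of `t` to the vertex (an input).  In other words it is the
normalisation of the edge labelled `A` from the vertex to the root of `t`.  Thus the list of the
first components is the sequent of the selected vertex.  The order of the list is irrelevant, see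
`Iso`. -/
inductive Position : Type
  | node (s : Player) (cs : List (Formula × Position)) : Position

/-- The sign of the vertex that holds the token (the selected vertex). -/
def Position.holder : Position → Player
  | .node s _ => s

/-- Isomorphism of positions: the relation generated by permuting the edges adjacent to a vertex
and replacing a subtree by an isomorphic one. -/
inductive Iso : Position → Position → Prop
  | refl (t : Position) : Iso t t
  | symm {t u : Position} : Iso t u → Iso u t
  | trans {t u w : Position} : Iso t u → Iso u w → Iso t w
  | perm (s : Player) {cs ds : List (Formula × Position)} :
      cs.Perm ds → Iso (.node s cs) (.node s ds)
  | congr (s : Player) (A : Formula) {t u : Position} (cs : List (Formula × Position)) :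
      Iso t u → Iso (.node s ((A, t) :: cs)) (.node s ((A, u) :: cs))

/-! ## Moves -/

/-- The moves, drawn with the broken edge first among the edges of the active vertex.  The active
vertex has sign `s`, the passive one has sign `s'` and further edges `Δ`.  Note that an edge with
label `A` from a vertex to the passive vertex is seen by the latter as `A.dual`. -/
inductive BasicMove : Position → Position → Prop
  /-- Pass the token along an input edge, leaving the tree unchanged. -/
  | negative (s s' : Player) (Γ Δ : List (Formula × Position)) (A : Formula) :
      A.IsNegative →
      BasicMove (.node s ((A, .node s' Δ) :: Γ)) (.node s' ((A.dual, .node s Γ) :: Δ))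
  /-- A vertex whose sole adjacent edge is an output `1` passes the token along it and is deleted
  together with the edge. -/
  | one (s s' : Player) (Δ : List (Formula × Position)) :
      BasicMove (.node s [(.one, .node s' Δ)]) (.node s' Δ)
  /-- Break an output `A ⊗ B`: the active vertex is split in two; the subtrees `Θ`, all attached by
  outputs of the form `?C`, are copied. -/
  | tensor (s s' : Player) (Γ Γ' Θ Δ : List (Formula × Position)) (A B : Formula) :
      (∀ c ∈ Θ, ∃ C : Formula, c.1 = .whynot C) →
      BasicMove (.node s ((.tensor A B, .node s' Δ) :: (Γ ++ Θ ++ Γ')))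
        (.node s' ((A.dual, .node s (Γ ++ Θ)) :: (B.dual, .node s (Θ ++ Γ')) :: Δ))
  | plusLeft (s s' : Player) (Γ Δ : List (Formula × Position)) (A B : Formula) :
      BasicMove (.node s ((.plus A B, .node s' Δ) :: Γ)) (.node s' ((A.dual, .node s Γ) :: Δ))
  | plusRight (s s' : Player) (Γ Δ : List (Formula × Position)) (A B : Formula) :
      BasicMove (.node s ((.plus A B, .node s' Δ) :: Γ)) (.node s' ((B.dual, .node s Γ) :: Δ))
  /-- Replace an output `?C` by an input `⊗ⁿ C.dual`. -/
  | whynot (s s' : Player) (Γ Δ : List (Formula × Position)) (C : Formula) (n : ℕ) :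
      BasicMove (.node s ((.whynot C, .node s' Δ) :: Γ))
        (.node s' ((C.dual.tensorPow n, .node s Γ) :: Δ))

/-- Moves between positions: basic moves up to isomorphism of the source and of the target. -/
def Move (p q : Position) : Prop :=
  ∃ p' q' : Position, Iso p p' ∧ BasicMove p' q' ∧ Iso q' q

/-! ## Plays, strategies, validity -/

/-- `π` lists the positions, after the initial one, of a play from `p`. -/
def IsPlay (p : Position) (π : List Position) : Prop :=
  List.IsChain Move (p :: π)

/-- The last position of the play `π` from `p`. -/
def final (p : Position) (π : List Position) : Position :=
  π.getLastD p

/-- Strategies on the position `p`: sets of plays from `p` that contain the empty play, are closed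
under prefixes, welcoming (every move of an opponent is accepted) and stable under isomorphism
of plays. -/
structure IsStrategy (p : Position) (S : Set (List Position)) : Prop where
  isPlay : ∀ π ∈ S, IsPlay p π
  nil_mem : [] ∈ S
  mem_of_isPrefix : ∀ π ∈ S, ∀ π' : List Position, π' <+: π → π' ∈ S
  welcoming : ∀ π ∈ S, (final p π).holder = Player.opponent →
    ∀ q : Position, Move (final p π) q → π ++ [q] ∈ S
  stable : ∀ π ∈ S, ∀ π' : List Position, IsPlay p π' → List.Forall₂ Iso π π' → π' ∈ S

/-- A play of `S` is maximal when `S` contains no proper extension of it. -/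
def IsMaximalIn (S : Set (List Position)) (π : List Position) : Prop :=
  π ∈ S ∧ ∀ π' ∈ S, π <+: π' → π' = π

/-- A strategy is winning when at the end of each of its maximal plays an opponent holds the
token. -/
def IsWinningStrategy (p : Position) (S : Set (List Position)) : Prop :=
  IsStrategy p S ∧ ∀ π : List Position, IsMaximalIn S π → (final p π).holder = Player.opponent

/-- All vertices of the tree have sign `s`. -/
inductive AllSigned (s : Player) : Position → Prop
  | node (cs : List (Formula × Position)) :
      (∀ c ∈ cs, AllSigned s c.2) → AllSigned s (.node s cs)

/-- The tree made of `U`, `V` and an edge labelled `A` from the selected vertex of `U` to the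
selected vertex of `V`, with the token on the selected vertex of `U`. -/
def connect : Position → Formula → Position → Position
  | .node s cs, A, V => .node s ((A, V) :: cs)

/-- Displace the token to an adjacent vertex of the same tree, in whatever direction the edge
goes.  (This is not a move of the game.) -/
inductive Displace : Position → Position → Prop
  | step (s s' : Player) (Γ Γ' Δ : List (Formula × Position)) (A : Formula) :
      Displace (.node s (Γ ++ (A, .node s' Δ) :: Γ'))
        (.node s' ((A.dual, .node s (Γ ++ Γ')) :: Δ))

/-- `q` is the same tree as `p`, with the token placed at an arbitrary vertex. -/
def SameTree (p q : Position) : Prop :=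
  Relation.ReflTransGen Displace p q

/-- Validity: there is a tree `U` of proponents such that for every tree `V` of opponents, the
proponents have a winning strategy on `U` connected to `V` by an edge labelled `A`, wherever the
token is placed initially. -/
def Valid (A : Formula) : Prop :=
  ∃ U : Position, AllSigned Player.proponent U ∧
    ∀ V : Position, AllSigned Player.opponent V →
      ∀ p : Position, SameTree (connect U A V) p →
        ∃ S : Set (List Position), IsWinningStrategy p S

end GLLTN

namespace GLLTN

/-! The two statements are proved independently. For the calculus, read the formulae as booleans,
with the exponentials transparent: every rule, cut included, preserves the presence of a true
formula, and duality negates truth. For the game, winning strategies for `A` and `A.dual` are played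
against each other on a single tree. Each party can always move when it holds the token, so the play
would never end; but all plays are finite (`terminating`). Finiteness is a reducibility argument.
`Good A t`, defined by recursion on `A`, says that giving the token to `t` through an edge seen as
`A` leads to termination, whatever good subtrees come along. `Position.GoodEdges.terminating` shows
that good subtrees make a position terminate, by induction on the multiset of the ranks at the
active vertex. Copying in the tensor move is harmless, because the two copies land in different
subtrees, neither larger than the original. Structural induction then makes every subtree good. -/

/-! ## Consistency of the calculus -/

/-- The classical truth value of a formula. -/
def Formula.truth : Formula → Bool
  | .zero => false
  | .one => true
  | .tensor A B => A.truth && B.truth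
  | .plus A B => A.truth || B.truth
  | .whynot A => A.truth
  | .top => true
  | .bot => false
  | .par A B => A.truth || B.truth
  | .wth A B => A.truth && B.truth
  | .bang A => A.truth

theorem Formula.dual_dual (A : Formula) : A.dual.dual = A := by
  induction A <;> simp_all [Formula.dual]

theorem Formula.truth_dual (A : Formula) : A.dual.truth = !A.truth := by
  induction A <;> simp_all [Formula.dual, Formula.truth]

theorem Formula.truth_parPow {A : Formula} {n : ℕ} (h : (A.parPow n).truth = true) :
    A.truth = true := by
  induction n with
  | zero => simp [Formula.parPow, Formula.truth] at h
  | succ n ih =>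
    simp only [Formula.parPow, Formula.truth, Bool.or_eq_true] at h
    exact h.elim ih id

/-- Every provable sequent contains a formula that is classically true. -/
theorem Provable.exists_truth {Γ : List Formula} (h : Provable Γ) :
    ∃ A ∈ Γ, A.truth = true := by
  induction h with
  | one => simp [Formula.truth]
  | bot Γ _ ih => obtain ⟨A, hA, h⟩ := ih; exact ⟨A, by simp [hA], h⟩
  | top Γ => exact ⟨.top, by simp, rfl⟩
  | tensor Γ Δ Θ A B _ _ ih₁ ih₂ =>
    obtain ⟨C, hC, hC'⟩ := ih₁
    obtain ⟨D, hD, hD'⟩ := ih₂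
    simp only [List.mem_append, List.mem_singleton] at hC hD
    rcases hC with (hC | hC) | rfl
    · exact ⟨C, by simp only [List.mem_append]; tauto, hC'⟩
    · exact ⟨C, by simp only [List.mem_append]; tauto, hC'⟩
    rcases hD with (hD | hD) | rfl
    · exact ⟨D, by simp only [List.mem_append]; tauto, hD'⟩
    · exact ⟨D, by simp only [List.mem_append]; tauto, hD'⟩
    · exact ⟨.tensor C D, by simp, by simp [Formula.truth, hC', hD']⟩
  | par Γ A B _ ih =>
    obtain ⟨C, hC, h⟩ := ih
    simp only [List.mem_append, List.mem_cons, List.not_mem_nil, or_false] at hC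
    rcases hC with hC | rfl | rfl
    · exact ⟨C, by simp [hC], h⟩
    · exact ⟨.par C B, by simp, by simp [Formula.truth, h]⟩
    · exact ⟨.par A C, by simp, by simp [Formula.truth, h]⟩
  | plusLeft Γ A B _ ih =>
    obtain ⟨C, hC, h⟩ := ih
    simp only [List.mem_append, List.mem_singleton] at hC
    rcases hC with hC | rfl
    · exact ⟨C, by simp [hC], h⟩
    · exact ⟨.plus C B, by simp, by simp [Formula.truth, h]⟩
  | plusRight Γ A B _ ih =>
    obtain ⟨C, hC, h⟩ := ih
    simp only [List.mem_append, List.mem_singleton] at hC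
    rcases hC with hC | rfl
    · exact ⟨C, by simp [hC], h⟩
    · exact ⟨.plus A C, by simp, by simp [Formula.truth, h]⟩
  | wth Γ A B _ _ ih₁ ih₂ =>
    obtain ⟨C, hC, hC'⟩ := ih₁
    obtain ⟨D, hD, hD'⟩ := ih₂
    simp only [List.mem_append, List.mem_singleton] at hC hD
    rcases hC with hC | rfl
    · exact ⟨C, by simp [hC], hC'⟩
    rcases hD with hD | rfl
    · exact ⟨D, by simp [hD], hD'⟩
    · exact ⟨.wth C D, by simp, by simp [Formula.truth, hC', hD']⟩
  | whynot Γ A n _ ih =>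
    obtain ⟨C, hC, h⟩ := ih
    simp only [List.mem_append, List.mem_singleton] at hC
    rcases hC with hC | rfl
    · exact ⟨C, by simp [hC], h⟩
    · exact ⟨.whynot A, by simp, Formula.truth_parPow (A := A) h⟩
  | bang Γ A _ ih =>
    -- The case `n = 1` suffices: `1 ⊗ A` has the truth value of `A`.
    obtain ⟨C, hC, h⟩ := ih 1
    simp only [List.mem_append, List.mem_singleton] at hC
    rcases hC with hC | rfl
    · exact ⟨C, by simp [hC], h⟩
    · refine ⟨.bang A, by simp, ?_⟩
      simpa [Formula.tensorPow, Formula.truth] using h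
  | exchange Γ Δ A B _ ih =>
    obtain ⟨C, hC, h⟩ := ih
    refine ⟨C, ?_, h⟩
    simp only [List.mem_append, List.mem_cons, List.not_mem_nil, or_false] at hC ⊢
    tauto
  | cut Γ Δ A _ _ ih₁ ih₂ =>
    obtain ⟨C, hC, hC'⟩ := ih₁
    obtain ⟨D, hD, hD'⟩ := ih₂
    simp only [List.mem_append, List.mem_singleton] at hC hD
    rcases hC with hC | rfl
    · exact ⟨C, by simp [hC], hC'⟩
    rcases hD with hD | rfl
    · exact ⟨D, by simp [hD], hD'⟩
    · simp [Formula.truth_dual, hC'] at hD'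

/-! ## Termination -/

/-- Only finite plays start at the position `p`. -/
def Terminating (p : Position) : Prop :=
  Acc (fun q p => Move p q) p

theorem Terminating.of_iso {p q : Position} (h : Terminating p) (hpq : Iso p q) :
    Terminating q :=
  Acc.intro q fun _ ⟨p', q', h₁, h₂, h₃⟩ => h.inv ⟨p', q', hpq.trans h₁, h₂, h₃⟩

/-- Add edges at the selected vertex. -/
def Position.addEdges (cs : List (Formula × Position)) : Position → Position
  | .node s ds => .node s (cs ++ ds)

theorem Iso.addEdges (es : List (Formula × Position)) {t u : Position} (h : Iso t u) :
    Iso (t.addEdges es) (u.addEdges es) := by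
  induction h with
  | refl t => exact .refl _
  | symm _ ih => exact ih.symm
  | trans _ _ ih₁ ih₂ => exact ih₁.trans ih₂
  | perm s h => exact .perm s (h.append_left es)
  | congr s A cs h _ =>
    exact ((Iso.perm s List.perm_middle).trans (.congr s A (es ++ cs) h)).trans
      (.perm s List.perm_middle.symm)

/-- An ordinal measure of formulae that decreases when an edge is broken. -/
noncomputable def Formula.rank : Formula → Ordinal.{0}
  | .zero => 0
  | .one => 0
  | .tensor A B => max A.rank B.rank + 1
  | .plus A B => max A.rank B.rank + 1
  | .whynot A => A.rank + Ordinal.omega0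
  | .top => 0
  | .bot => 0
  | .par A B => max A.rank B.rank + 1
  | .wth A B => max A.rank B.rank + 1
  | .bang A => A.rank + Ordinal.omega0

theorem Formula.rank_dual (A : Formula) : A.dual.rank = A.rank := by
  induction A <;> simp_all [Formula.dual, Formula.rank]

/-- Each further factor costs at most one, so adding `ω` in the rank of an exponential exceeds all
the powers at once. -/
theorem Formula.rank_tensorPow_le (A : Formula) (n : ℕ) :
    (A.tensorPow n).rank ≤ A.rank + n := by
  induction n with
  | zero => simp [Formula.tensorPow, Formula.rank]
  | succ n ih =>
    simp only [Formula.tensorPow, Formula.rank, Nat.cast_succ, ← add_assoc]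
    gcongr
    exact max_le ih le_self_add

/-- `Breaks A L` says that an output `A` may be broken in such a way that the passive vertex
receives edges that it sees as the members of `L`. -/
inductive Breaks : Formula → List Formula → Prop
  | one : Breaks .one []
  | tensor (A B : Formula) : Breaks (.tensor A B) [A.dual, B.dual]
  | plusLeft (A B : Formula) : Breaks (.plus A B) [A.dual]
  | plusRight (A B : Formula) : Breaks (.plus A B) [B.dual]
  | whynot (C : Formula) (n : ℕ) : Breaks (.whynot C) [C.dual.tensorPow n]

theorem Breaks.rank_lt {A : Formula} {L : List Formula} (h : Breaks A L) {D : Formula}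
    (hD : D ∈ L) : D.rank < A.rank := by
  cases h with
  | one => simp at hD
  | tensor A B =>
    simp only [List.mem_cons, List.not_mem_nil, or_false] at hD
    rcases hD with rfl | rfl <;> simp [Formula.rank, Formula.rank_dual]
  | plusLeft A B =>
    simp only [List.mem_singleton] at hD
    subst hD
    simp [Formula.rank, Formula.rank_dual]
  | plusRight A B =>
    simp only [List.mem_singleton] at hD
    subst hD
    simp [Formula.rank, Formula.rank_dual]
  | whynot C n =>
    simp only [List.mem_singleton] at hD
    subst hD
    refine (Formula.rank_tensorPow_le _ n).trans_lt ?_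
    simp only [Formula.rank, Formula.rank_dual]
    gcongr
    exact Ordinal.natCast_lt_omega0 n

theorem Formula.IsNegative.not_dual {A : Formula} (h : A.IsNegative) : ¬ A.dual.IsNegative := by
  cases A <;> simp_all [Formula.dual, Formula.IsNegative]

open Classical in
/-- A measure of the polarity of a formula, `1` for negative formulae and `0` for positive ones. -/
noncomputable def Formula.polarity (A : Formula) : ℕ := if A.IsNegative then 1 else 0

theorem Formula.IsNegative.polarity_dual_lt {A : Formula} (h : A.IsNegative) :
    A.dual.polarity < A.polarity := by
  simp [Formula.polarity, h, h.not_dual]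

/-- The reducibility predicate: `Good A t` says that `t` may safely be put at the other end of an
edge seen as `A`. -/
def Good (A : Formula) (t : Position) : Prop :=
  (∀ L, Breaks A L → ∀ cs : List (Formula × Position), cs.map Prod.fst = L →
    (∀ c, ∀ _ : c ∈ cs, Good c.1 c.2) → Terminating (t.addEdges cs)) ∧
  (A.IsNegative → ∀ u, Good A.dual u → Terminating (t.addEdges [(A.dual, u)]))
-- Breaking an edge lowers the rank. Passing the token keeps it but turns a negative formula into a
-- positive one, whose second clause is void.
termination_by (A.rank, A.polarity)
decreasing_by
  · refine Prod.Lex.left _ _ (Breaks.rank_lt ‹Breaks A L› ?_)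
    rw [← ‹cs.map Prod.fst = L›]
    exact List.mem_map_of_mem ‹c ∈ cs›
  · rw [A.rank_dual]
    exact Prod.Lex.right _ (Formula.IsNegative.polarity_dual_lt ‹_›)

theorem Good.of_iso {A : Formula} {t u : Position} (h : Good A t) (htu : Iso t u) : Good A u := by
  rw [Good] at h ⊢
  exact ⟨fun L hL cs hcs hg => (h.1 L hL cs hcs hg).of_iso (htu.addEdges cs),
    fun hA v hv => (h.2 hA v hv).of_iso (htu.addEdges _)⟩

theorem good_iff_of_iso {A : Formula} {t u : Position} (h : Iso t u) : Good A t ↔ Good A u :=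
  ⟨fun ht => ht.of_iso h, fun hu => hu.of_iso h.symm⟩

/-- The edges of the selected vertex. -/
def Position.edges : Position → List (Formula × Position)
  | .node _ cs => cs

/-- The multiset of the ranks of the edges of the selected vertex. -/
noncomputable def Position.ranks (p : Position) : Multiset Ordinal.{0} :=
  (p.edges.map fun c => c.1.rank : List Ordinal.{0})

theorem Iso.ranks_eq {p q : Position} (h : Iso p q) : p.ranks = q.ranks := by
  induction h with
  | refl t => rfl
  | symm _ ih => exact ih.symm
  | trans _ _ ih₁ ih₂ => exact ih₁.trans ih₂
  | perm s h => exact Multiset.coe_eq_coe.2 (h.map _)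
  | congr s A cs h _ => simp [Position.ranks, Position.edges]

/-- All subtrees at the selected vertex are reducible. -/
def Position.GoodEdges (p : Position) : Prop :=
  ∀ c ∈ p.edges, Good c.1 c.2

theorem Iso.goodEdges_iff {p q : Position} (h : Iso p q) : p.GoodEdges ↔ q.GoodEdges := by
  induction h with
  | refl t => rfl
  | symm _ ih => exact ih.symm
  | trans _ _ ih₁ ih₂ => exact ih₁.trans ih₂
  | perm s h => simp [Position.GoodEdges, Position.edges, h.mem_iff]
  | congr s A cs h _ => simp [Position.GoodEdges, Position.edges, good_iff_of_iso h]

/-- A vertex with reducible subtrees is reducible along a further edge, provided that it terminates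
when edges of small rank are added. -/
theorem good_of_forall_terminating {D : Formula} {t : Position} {o : Ordinal.{0}}
    (hle : D.rank ≤ o) (hlt : D.IsNegative → D.rank < o)
    (H : ∀ cs : List (Formula × Position), (∀ c ∈ cs, Good c.1 c.2) →
      (∀ c ∈ cs, c.1.rank < o) → Terminating (t.addEdges cs)) : Good D t := by
  rw [Good]
  -- Breaking attaches edges of rank below `D.rank`; passing the token attaches one of exactly that
  -- rank, whence the strict bound for negative `D`.
  refine ⟨fun L hL cs hcs hg => H cs hg fun c hc =>
    (hL.rank_lt (hcs ▸ List.mem_map_of_mem hc)).trans_le hle, fun hD u hu => H _ ?_ ?_⟩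
  · simpa using hu
  · simpa [Formula.rank_dual] using hlt hD

/-- A position whose selected vertex has reducible subtrees only is terminating. -/
theorem Position.GoodEdges.terminating {p : Position} (hp : p.GoodEdges) : Terminating p := by
  induction hM : p.ranks using
    (Multiset.wellFounded_isDershowitzMannaLT (α := Ordinal.{0})).induction generalizing p with
  | _ M IH =>
  -- What is left of the active vertex after a move is good: when the token returns to it, the edge
  -- `A` has been replaced by edges of smaller rank, so the induction hypothesis applies.
  have key : ∀ (s : Player) (A : Formula) (t : Position) (Γ Γ' : List (Formula × Position)),
      Iso p (.node s ((A, t) :: Γ)) → Γ'.Subperm Γ → ∀ D : Formula,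
      D.rank ≤ A.rank → (D.IsNegative → D.rank < A.rank) → Good D (.node s Γ') := by
    intro s A t Γ Γ' hiso hΓ D h₁ h₂
    have hg := hiso.goodEdges_iff.1 hp
    refine good_of_forall_terminating h₁ h₂ fun cs hcs hr => ?_
    refine IH (Position.node s (cs ++ Γ')).ranks ?_ ?_ rfl
    · have hle : (Γ'.map fun c => c.1.rank : Multiset Ordinal.{0}) ≤
          (Γ.map fun c => c.1.rank : List Ordinal.{0}) := by
        have := Multiset.map_le_map (f := fun c : Formula × Position => c.1.rank)
          (Multiset.coe_le.2 hΓ)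
        simpa using this
      obtain ⟨Z, hZ⟩ := Multiset.le_iff_exists_add.1 hle
      -- The ranks of `Γ'` are common to both multisets. Those of `cs` replace `A.rank` and the
      -- ranks `Z` of the edges lost, and `A.rank` dominates them.
      refine ⟨(Γ'.map fun c => c.1.rank : List Ordinal.{0}),
        (cs.map fun c => c.1.rank : List Ordinal.{0}), A.rank ::ₘ Z, by simp, ?_, ?_, ?_⟩
      · simp [Position.ranks, Position.edges, List.perm_append_comm]
      · rw [← hM, hiso.ranks_eq, Multiset.add_cons, ← hZ]
        simp [Position.ranks, Position.edges]
      · intro y hy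
        simp only [Multiset.mem_coe, List.mem_map] at hy
        obtain ⟨c, hc, rfl⟩ := hy
        exact ⟨A.rank, by simp, hr c hc⟩
    · intro c hc
      rcases List.mem_append.1 hc with hc | hc
      · exact hcs c hc
      · exact hg c (List.mem_cons_of_mem _ (hΓ.subset hc))
  refine Acc.intro p fun q ⟨p', q', h₁, hb, h₃⟩ => ?_
  refine Terminating.of_iso ?_ h₃
  have hg := h₁.goodEdges_iff.1 hp
  have brk : ∀ (s s' : Player) (A : Formula) (Γ Δ cs : List (Formula × Position)),
      p' = .node s ((A, .node s' Δ) :: Γ) → Breaks A (cs.map Prod.fst) →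
      (∀ c ∈ cs, ∃ Γ' : List (Formula × Position), c.2 = .node s Γ' ∧ Γ'.Subperm Γ) →
      Terminating (.node s' (cs ++ Δ)) := by
    rintro s s' A Γ Δ cs rfl hA hcs
    have h := hg (A, .node s' Δ) (by simp [Position.edges])
    rw [Good] at h
    refine h.1 _ hA cs rfl fun c hc => ?_
    obtain ⟨Γ', hc', hΓ⟩ := hcs c hc
    have hr := hA.rank_lt (List.mem_map_of_mem hc)
    rw [hc']
    exact key s A _ Γ Γ' h₁ hΓ c.1 hr.le fun _ => hr
  cases hb with
  | negative s s' Γ Δ A hA =>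
    have h := hg (A, .node s' Δ) (by simp [Position.edges])
    rw [Good] at h
    -- The rank does not drop here, but `A.dual` is positive, so `key` asks for no strict
    -- inequality.
    exact h.2 hA _ (key s A _ Γ Γ h₁ (List.Subperm.refl _) _ A.rank_dual.le
      fun h' => absurd h' hA.not_dual)
  | one s s' Δ => exact brk s s' .one [] Δ [] rfl .one (by simp)
  | tensor s s' Γ Γ' Θ Δ A B _ =>
    refine brk s s' _ _ Δ [(A.dual, .node s (Γ ++ Θ)), (B.dual, .node s (Θ ++ Γ'))] rfl
      (.tensor A B) ?_
    simp only [List.mem_cons, List.not_mem_nil, or_false, forall_eq_or_imp, forall_eq]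
    refine ⟨⟨_, rfl, (List.sublist_append_left _ _).subperm⟩, ⟨_, rfl, ?_⟩⟩
    rw [List.append_assoc]
    exact (List.sublist_append_right _ _).subperm
  | plusLeft s s' Γ Δ A B =>
    exact brk s s' _ Γ Δ [(A.dual, .node s Γ)] rfl (.plusLeft A B)
      (by simpa using List.Subperm.refl Γ)
  | plusRight s s' Γ Δ A B =>
    exact brk s s' _ Γ Δ [(B.dual, .node s Γ)] rfl (.plusRight A B)
      (by simpa using List.Subperm.refl Γ)
  | whynot s s' Γ Δ C n =>
    exact brk s s' _ Γ Δ [(C.dual.tensorPow n, .node s Γ)] rfl (.whynot C n)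
      (by simpa using List.Subperm.refl Γ)

/-- Attaching good subtrees to `t` keeps all its edges good, hence it terminates. The bound `A.rank
+ 1` only makes the rank conditions hold, and the resulting bound on `cs` is discarded. -/
theorem good_of_goodEdges {t : Position} (h : t.GoodEdges) (A : Formula) : Good A t := by
  refine good_of_forall_terminating (o := A.rank + 1) (by simp) (fun _ => by simp)
    fun cs hcs _ => Position.GoodEdges.terminating fun c hc => ?_
  cases t with
  | node s ds => exact (List.mem_append.1 hc).elim (hcs c) (h c)

theorem goodEdges (t : Position) : t.GoodEdges := by
  match t with
  | .node s cs => exact fun c hc => good_of_goodEdges (goodEdges c.2) c.1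
termination_by t
decreasing_by
  have h₁ := List.sizeOf_lt_of_mem hc
  have h₂ : sizeOf c = 1 + sizeOf c.1 + sizeOf c.2 := rfl
  simp only [Position.node.sizeOf_spec, Position.edges] at *
  omega

/-- All plays are finite. -/
theorem terminating (p : Position) : Terminating p :=
  (goodEdges p).terminating

/-! ## Exchanging the players -/

/-- The other player. -/
def Player.swap : Player → Player
  | .proponent => .opponent
  | .opponent => .proponent

/-- The same position with the players exchanged. -/
def Position.swap : Position → Position
  | .node s cs => .node s.swap (cs.attach.map fun c => (c.1.1, c.1.2.swap))
decreasing_by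
  have h₁ := List.sizeOf_lt_of_mem c.2
  have h₂ : sizeOf c.1 = 1 + sizeOf c.1.1 + sizeOf c.1.2 := rfl
  simp only [Position.node.sizeOf_spec]
  omega

/-- Exchange of the players in the subtrees of a list. -/
def swapEdges (cs : List (Formula × Position)) : List (Formula × Position) :=
  cs.map fun c => (c.1, c.2.swap)

theorem Position.swap_node (s : Player) (cs : List (Formula × Position)) :
    (Position.node s cs).swap = .node s.swap (swapEdges cs) := by
  simp only [Position.swap, swapEdges, List.map_attach_eq_pmap, List.pmap_eq_map]

@[simp]
theorem swapEdges_cons (A : Formula) (t : Position) (cs : List (Formula × Position)) :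
    swapEdges ((A, t) :: cs) = (A, t.swap) :: swapEdges cs := rfl

@[simp]
theorem swapEdges_append (cs ds : List (Formula × Position)) :
    swapEdges (cs ++ ds) = swapEdges cs ++ swapEdges ds := List.map_append

theorem Player.swap_swap (s : Player) : s.swap.swap = s := by cases s <;> rfl

theorem Position.swap_swap (t : Position) : t.swap.swap = t := by
  match t with
  | .node s cs =>
    have h : ∀ c ∈ cs, c.2.swap.swap = c.2 := fun c hc => Position.swap_swap c.2
    rw [Position.swap_node, Position.swap_node, Player.swap_swap]
    congr 1
    simp only [swapEdges, List.map_map]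
    refine (List.map_congr_left fun c hc => ?_).trans (List.map_id cs)
    exact Prod.ext rfl (h c hc)
termination_by t
decreasing_by
  have h₁ := List.sizeOf_lt_of_mem hc
  have h₂ : sizeOf c = 1 + sizeOf c.1 + sizeOf c.2 := rfl
  simp only [Position.node.sizeOf_spec] at *
  omega

theorem Position.holder_swap (t : Position) : t.swap.holder = t.holder.swap := by
  cases t
  rw [Position.swap_node]
  rfl

theorem Iso.swap {t u : Position} (h : Iso t u) : Iso t.swap u.swap := by
  induction h with
  | refl t => exact .refl _
  | symm _ ih => exact ih.symm
  | trans _ _ ih₁ ih₂ => exact ih₁.trans ih₂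
  | perm s h => simpa only [Position.swap_node] using! Iso.perm _ (h.map _)
  | congr s A cs _ ih =>
    simpa only [Position.swap_node, swapEdges_cons] using Iso.congr _ A _ ih

theorem BasicMove.swap {p q : Position} (h : BasicMove p q) : BasicMove p.swap q.swap := by
  cases h with
  | negative s s' Γ Δ A hA =>
    simpa only [Position.swap_node, swapEdges_cons] using BasicMove.negative _ _ _ _ A hA
  | one s s' Δ =>
    simpa only [Position.swap_node, swapEdges_cons] using! BasicMove.one _ _ _
  | tensor s s' Γ Γ' Θ Δ A B hΘ =>
    simp only [Position.swap_node, swapEdges_cons, swapEdges_append]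
    refine BasicMove.tensor _ _ _ _ _ _ A B fun c hc => ?_
    obtain ⟨d, hd, rfl⟩ := List.mem_map.1 hc
    exact hΘ d hd
  | plusLeft s s' Γ Δ A B =>
    simpa only [Position.swap_node, swapEdges_cons] using BasicMove.plusLeft _ _ _ _ A B
  | plusRight s s' Γ Δ A B =>
    simpa only [Position.swap_node, swapEdges_cons] using BasicMove.plusRight _ _ _ _ A B
  | whynot s s' Γ Δ C n =>
    simpa only [Position.swap_node, swapEdges_cons] using BasicMove.whynot _ _ _ _ C n

theorem Move.swap {p q : Position} (h : Move p q) : Move p.swap q.swap := by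
  obtain ⟨p', q', h₁, h₂, h₃⟩ := h
  exact ⟨_, _, h₁.swap, h₂.swap, h₃.swap⟩

theorem AllSigned.swap {s : Player} {t : Position} (h : AllSigned s t) :
    AllSigned s.swap t.swap := by
  induction h with
  | node cs _ ih =>
    rw [Position.swap_node]
    refine .node _ fun c hc => ?_
    obtain ⟨d, hd, rfl⟩ := List.mem_map.1 hc
    exact ih d hd

/-! ## Playing two winning strategies against each other -/

theorem final_append_singleton (p q : Position) (π : List Position) : final p (π ++ [q]) = q := by
  simp [final]

/-- A play of a winning strategy at whose end a proponent holds the token is extended by the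
strategy. -/
theorem IsWinningStrategy.exists_move {p : Position} {S : Set (List Position)}
    (h : IsWinningStrategy p S) {π : List Position} (hπ : π ∈ S)
    (hp : (final p π).holder = .proponent) : ∃ q, Move (final p π) q ∧ π ++ [q] ∈ S := by
  by_contra hcon
  have hmax : IsMaximalIn S π := by
    refine ⟨hπ, ?_⟩
    rintro _ hπ' ⟨ρ, rfl⟩
    cases ρ with
    | nil => simp
    | cons q ρ =>
      have hq : π ++ [q] ∈ S := h.1.mem_of_isPrefix _ hπ' _ ⟨ρ, by simp⟩
      refine absurd ⟨q, ?_, hq⟩ hcon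
      have hc : List.IsChain Move ((p :: π) ++ [q]) := h.1.isPlay _ hq
      rw [List.isChain_append] at hc
      refine hc.2.2 _ ?_ q (by simp)
      simp [final, List.getLast?_cons, List.getLastD_eq_getLast?]
  rw [h.2 π hmax] at hp
  cases hp

theorem final_map_swap (p : Position) (π : List Position) :
    final p.swap (π.map Position.swap) = (final p π).swap := by
  simp only [final, List.getLastD_eq_getLast?, List.getLast?_map]
  cases π.getLast? <;> rfl

/-- The two parties cannot both have a winning strategy. -/
theorem not_both_winning {p : Position} {S T : Set (List Position)}
    (hS : IsWinningStrategy p S) (hT : IsWinningStrategy p.swap T) : False := by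
  -- A play common to both strategies always extends to a longer common play, which is impossible by
  -- induction on the accessibility of its last position.
  have main : ∀ q, Terminating q → ∀ π ∈ S, π.map Position.swap ∈ T → final p π ≠ q := by
    intro q hq
    induction hq with
    | intro q _ ih =>
    rintro π hπS hπT rfl
    suffices ∃ r, Move (final p π) r ∧ π ++ [r] ∈ S ∧ (π ++ [r]).map Position.swap ∈ T by
      obtain ⟨r, hr, hrS, hrT⟩ := this
      exact ih r hr _ hrS hrT (final_append_singleton p r π)
    have hh : (final p.swap (π.map Position.swap)).holder = (final p π).holder.swap := by
      rw [final_map_swap, Position.holder_swap]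
    -- The strategy for which the holder is a proponent supplies the move; the other accepts it by
    -- `welcoming`.
    cases hholder : (final p π).holder with
    | proponent =>
      obtain ⟨r, hr, hrS⟩ := hS.exists_move hπS hholder
      refine ⟨r, hr, hrS, ?_⟩
      rw [List.map_append]
      refine hT.1.welcoming _ hπT (by rw [hh, hholder]; rfl) _ ?_
      rw [final_map_swap]
      exact hr.swap
    | opponent =>
      obtain ⟨r, hr, hrT⟩ := hT.exists_move hπT (by rw [hh, hholder]; rfl)
      rw [final_map_swap] at hr
      have hr' : Move (final p π) r.swap := by simpa only [Position.swap_swap] using hr.swap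
      refine ⟨r.swap, hr', hS.1.welcoming _ hπS hholder _ hr', ?_⟩
      simpa only [List.map_append, List.map_cons, List.map_nil, Position.swap_swap] using hrT
  exact main _ (terminating _) [] hS.1.nil_mem hT.1.nil_mem rfl

theorem not_valid_and_valid_dual (A : Formula) : ¬ (Valid A ∧ Valid A.dual) := by
  rintro ⟨⟨U, hU, hUwin⟩, ⟨U', hU', hUwin'⟩⟩
  obtain ⟨S, hS⟩ := hUwin U'.swap hU'.swap _ .refl
  obtain ⟨s, cs⟩ := U
  obtain ⟨s', cs'⟩ := U'
  -- With the players exchanged, the tree on which `S` is played is the one to which the validity of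
  -- `A.dual` applies, but with the token at the other end of the joining edge. This is where
  -- arbitrary initial placements are needed.
  have hdisp : SameTree (connect (.node s' cs') A.dual (Position.node s cs).swap)
      (connect (.node s cs) A (Position.node s' cs').swap).swap := by
    refine .single ?_
    simp only [connect, Position.swap_node, swapEdges_cons, Player.swap_swap]
    have h := Displace.step s' s.swap [] cs' (swapEdges cs) A.dual
    have hcs' : swapEdges (swapEdges cs') = cs' := by
      have := Position.swap_swap (.node s' cs')
      simpa only [Position.swap_node, Position.node.injEq, Player.swap_swap, true_and] using this
    simpa only [List.nil_append, Formula.dual_dual, hcs'] using h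
  obtain ⟨T, hT⟩ := hUwin' _ hU.swap _ hdisp
  exact not_both_winning hS hT

theorem not_provable_and_provable_dual (A : Formula) :
    ¬ (Provable [A] ∧ Provable [A.dual]) := by
  rintro ⟨h, h'⟩
  obtain ⟨B, hB, hBt⟩ := h.exists_truth
  obtain ⟨C, hC, hCt⟩ := h'.exists_truth
  simp only [List.mem_singleton] at hB hC
  subst hB hC
  simp [Formula.truth_dual, hBt] at hCt

end GLLTN

theorem mainTheorem4 :
    (∀ A : GLLTN.Formula, ¬ (GLLTN.Valid A ∧ GLLTN.Valid A.dual)) ∧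
    (∀ A : GLLTN.Formula, ¬ (GLLTN.Provable [A] ∧ GLLTN.Provable [A.dual])) :=
  ⟨GLLTN.not_valid_and_valid_dual, GLLTN.not_provable_and_provable_dual⟩
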